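/- Fix an integer $R \ge 2$. For each $n$, let $\mathbf{G}_{n,R}$ be the set of all simple undirected graphs with vertex set $\{1,\dots,n\}$ in which every vertex has degree at most $R$. As $n \to \infty$: (i) The proportion of graphs $\mathcal{G} \in \mathbf{G}_{n,R}$ which have no vertex of degree less than $R-2$ tends to $1$. (ii) For every real $\varepsilon > 0$, the proportion of graphs $\mathcal{G} \in \mathbf{G}_{n,R}$ in which the number of vertices of degree exactly $R-1$ is at least $\sqrt{(R-\varepsilon)n}$ and at most $\sqrt{(R+\varepsilon)n}$ tends to $1$ (if $\varepsilon > R$, the lower bound is read as $0$). (iii) For every integer $k \ge 0$, the proportion of graphs $\mathcal{G} \in \mathbf{G}_{n,R}$ which have exactly $k$ vertices of degree $R-2$ tends to $$\frac{(R-1)^k\, e^{-(R-1)}}{k!}.$$ In other words, the number of vertices of degree $R-2$ in a uniformly random member of $\mathbf{G}_{n,R}$ has, asymptotically, a Poisson distribution with mean $R-1$. -/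

import Mathlib

namespace BoundedDegree

open Classical in
/-- The set of (simple, undirected) graphs on the `n` labelled vertices `Fin n` in which every
vertex has degree at most `R`. -/
noncomputable def graphs (n R : ℕ) : Finset (SimpleGraph (Fin n)) :=
  Finset.univ.filter fun G => ∀ v, G.degree v ≤ R

open Classical in
/-- The number of vertices of `G` having degree exactly `d`. -/
noncomputable def numDegree {n : ℕ} (G : SimpleGraph (Fin n)) (d : ℕ) : ℕ :=
  (Finset.univ.filter fun v => G.degree v = d).card

open Classical in
/-- `NoDegreeLT G d`: no vertex of `G` has degree less than `d`. -/
def NoDegreeLT {n : ℕ} (G : SimpleGraph (Fin n)) (d : ℕ) : Prop :=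
  ∀ v, ¬ G.degree v < d

open Classical in
/-- The proportion of those graphs on `n` labelled vertices with all degrees at most `R` that have
the property `P`, i.e. the probability of `P` under the uniform distribution on `graphs n R`. -/
noncomputable def proportion (n R : ℕ) (P : SimpleGraph (Fin n) → Prop) : ℝ :=
  (((graphs n R).filter P).card : ℝ) / ((graphs n R).card : ℝ)

/-- The set `graphs n R` is nonempty (it contains the edgeless graph), so the denominator in
`proportion` is never zero. -/
theorem graphs_nonempty (n R : ℕ) : (graphs n R).Nonempty :=
  ⟨⊥, by classical simp [graphs]⟩

end BoundedDegree

section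

open Finset Filter Topology
open scoped Classical symmDiff

namespace BoundedDegree

/-! ### Toggling edges -/

/-! Two reversible switchings, counted from both sides, determine everything. Write D for the number
of vertices of degree below R, and N_d for the number of degree d.

Toggling one edge matches pairs (graph, edge) with pairs (graph, addable nonedge). Since a vertex
has at most R neighbours, the ordered addable pairs number D² up to O(D), while the darts number Rn
up to O(D). Equality of the two averages gives E[D²] = O(n). More is true: the average of (addable −
darts)·h is O(√n) for any weight h that one added edge changes by O(1/√n)
(`abs_avg_addable_sub_darts_mul_le`). Taking h to be a ramp in N_{R-1}/√n or D/√n shows that N_{R-1}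
is rarely much above √(Rn) and D rarely much below it. The same toggling shows that triangles number
only O(√n) on average.

Toggling a triangle on v, x, y raises v from degree d to d+2 and fixes all other degrees. It matches
about N_d·Rn configurations with about (d+2)(d+1)·N_{d+2}. For d < R−2 this makes E[N_d] essentially
O(D/n), hence negligible, which is (i). For d = R−2, almost all vertices have degree R, so
restricting to N_{R-2} = k+1 on one side and N_{R-2} = k on the other gives (k+1)·P(k+1) ≈
(R−1)·P(k). With tightness from Markov's inequality this forces the Poisson law (iii). Finally D ≤
N_{R-1} + N_{R-2} with high probability and N_{R-2} is o(√n), so the lower bound on D passes to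
N_{R-1}, giving (ii). -/

theorem symmDiff_adj {V : Type*} (G H : SimpleGraph V) (a b : V) :
    (G ∆ H).Adj a b ↔ (G.Adj a b ∧ ¬ H.Adj a b) ∨ (H.Adj a b ∧ ¬ G.Adj a b) := by
  simp [symmDiff]

/-- Double counting along a family of involutions. -/
theorem sum_sum_involution {α ι : Type*} (S : Finset α) (A B : α → Finset ι)
    (φ : α → ι → α) (hφ : ∀ G t, φ (φ G t) t = G)
    (hAB : ∀ G ∈ S, ∀ t ∈ A G, φ G t ∈ S ∧ t ∈ B (φ G t))
    (hBA : ∀ G ∈ S, ∀ t ∈ B G, φ G t ∈ S ∧ t ∈ A (φ G t)) (h : α → ι → ℝ) :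
    ∑ G ∈ S, ∑ t ∈ A G, h G t = ∑ G ∈ S, ∑ t ∈ B G, h (φ G t) t := by
  rw [Finset.sum_sigma', Finset.sum_sigma']
  refine Finset.sum_nbij' (fun p => ⟨φ p.1 p.2, p.2⟩) (fun p => ⟨φ p.1 p.2, p.2⟩) ?_ ?_ ?_ ?_ ?_
  · rintro ⟨G, t⟩ hp
    simp only [mem_sigma] at hp ⊢
    exact hAB G hp.1 t hp.2
  · rintro ⟨G, t⟩ hp
    simp only [mem_sigma] at hp ⊢
    exact hBA G hp.1 t hp.2
  all_goals
    rintro ⟨G, t⟩ _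
    simp [hφ]

variable {n R : ℕ}

theorem mem_graphs {G : SimpleGraph (Fin n)} : G ∈ graphs n R ↔ ∀ v, G.degree v ≤ R := by
  simp only [graphs, mem_filter, mem_univ, true_and]

theorem numDegree_eq (G : SimpleGraph (Fin n)) (d : ℕ) :
    numDegree G d = #{v | G.degree v = d} := by
  unfold numDegree
  congr

theorem degree_congr {G G' : SimpleGraph (Fin n)} {w : Fin n}
    (h : ∀ z, G'.Adj w z ↔ G.Adj w z) : G'.degree w = G.degree w := by
  unfold SimpleGraph.degree
  congr 1
  ext z
  simp [h]

/-- The ordered adjacent pairs. -/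
noncomputable def darts (G : SimpleGraph (Fin n)) : Finset (Fin n × Fin n) :=
  {p | G.Adj p.1 p.2}

/-- The ordered pairs which may be joined without creating a degree above `R`. -/
noncomputable def addable (R : ℕ) (G : SimpleGraph (Fin n)) : Finset (Fin n × Fin n) :=
  {p | p.1 ≠ p.2 ∧ ¬ G.Adj p.1 p.2 ∧ G.degree p.1 < R ∧ G.degree p.2 < R}

theorem symmDiff_edge_adj {G : SimpleGraph (Fin n)} {u v a b : Fin n} (huv : u ≠ v) :
    (G ∆ SimpleGraph.edge u v).Adj a b ↔
      if (a = u ∧ b = v) ∨ (a = v ∧ b = u) then ¬ G.Adj u v else G.Adj a b := by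
  rw [symmDiff_adj, SimpleGraph.edge_adj]
  split_ifs with h
  · rcases h with ⟨rfl, rfl⟩ | ⟨rfl, rfl⟩
    · simp [huv]
    · simp [huv.symm, G.adj_comm]
  · simp [h]

theorem degree_symmDiff_edge_of_ne {G : SimpleGraph (Fin n)} {u v w : Fin n} (huv : u ≠ v)
    (hu : w ≠ u) (hv : w ≠ v) : (G ∆ SimpleGraph.edge u v).degree w = G.degree w := by
  apply degree_congr
  intro z
  rw [symmDiff_edge_adj huv]
  simp [hu, hv]

theorem degree_symmDiff_edge_left {G : SimpleGraph (Fin n)} {u v : Fin n} (huv : u ≠ v)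
    (h : ¬ G.Adj u v) : (G ∆ SimpleGraph.edge u v).degree u = G.degree u + 1 := by
  have : (G ∆ SimpleGraph.edge u v).neighborFinset u = insert v (G.neighborFinset u) := by
    ext z
    by_cases hz : z = v <;> simp [symmDiff_edge_adj huv, h, huv, hz]
  unfold SimpleGraph.degree
  rw [this, card_insert_of_notMem (by simpa using h)]

theorem degree_symmDiff_edge_right {G : SimpleGraph (Fin n)} {u v : Fin n} (huv : u ≠ v)
    (h : ¬ G.Adj u v) : (G ∆ SimpleGraph.edge u v).degree v = G.degree v + 1 := by
  have := degree_symmDiff_edge_left (G := G) huv.symm (fun h' => h h'.symm)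
  rwa [SimpleGraph.edge_comm] at this

theorem symmDiff_edge_mem_of_mem_addable {G : SimpleGraph (Fin n)} (hG : G ∈ graphs n R) {p : Fin n × Fin n}
    (hp : p ∈ addable R G) :
    G ∆ SimpleGraph.edge p.1 p.2 ∈ graphs n R ∧ p ∈ darts (G ∆ SimpleGraph.edge p.1 p.2) := by
  obtain ⟨u, v⟩ := p
  simp only [addable, mem_filter, mem_univ, true_and] at hp
  obtain ⟨huv, hadj, hu, hv⟩ := hp
  refine ⟨mem_graphs.2 fun w => ?_, ?_⟩
  · by_cases h1 : w = u
    · subst h1; rw [degree_symmDiff_edge_left huv hadj]; exact hu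
    by_cases h2 : w = v
    · subst h2; rw [degree_symmDiff_edge_right huv hadj]; exact hv
    rw [degree_symmDiff_edge_of_ne huv h1 h2]
    exact mem_graphs.1 hG w
  · simp [darts, symmDiff_edge_adj huv, hadj]

theorem symmDiff_edge_mem_of_mem_darts {G : SimpleGraph (Fin n)} (hG : G ∈ graphs n R) {p : Fin n × Fin n}
    (hp : p ∈ darts G) :
    G ∆ SimpleGraph.edge p.1 p.2 ∈ graphs n R ∧ p ∈ addable R (G ∆ SimpleGraph.edge p.1 p.2) := by
  obtain ⟨u, v⟩ := p
  simp only [darts, mem_filter, mem_univ, true_and] at hp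
  have huv : u ≠ v := hp.ne
  set G' := G ∆ SimpleGraph.edge u v with hG'
  -- Viewing G as G' with the edge added lets the degree formulas for addition serve for deletion.
  have hGG : G = G' ∆ SimpleGraph.edge u v := by simp [hG']
  have hadj : ¬ G'.Adj u v := by simp [hG', symmDiff_edge_adj huv, hp]
  have hb := mem_graphs.1 hG
  have hu : G'.degree u + 1 ≤ R := by
    rw [← degree_symmDiff_edge_left huv hadj, ← hGG]; exact hb u
  have hv : G'.degree v + 1 ≤ R := by
    rw [← degree_symmDiff_edge_right huv hadj, ← hGG]; exact hb v
  refine ⟨mem_graphs.2 fun w => ?_, ?_⟩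
  · by_cases h1 : w = u
    · subst h1; exact le_trans (Nat.le_succ _) hu
    by_cases h2 : w = v
    · subst h2; exact le_trans (Nat.le_succ _) hv
    rw [hG', degree_symmDiff_edge_of_ne huv h1 h2]
    exact hb w
  · simp only [addable, mem_filter, mem_univ, true_and]
    exact ⟨huv, hadj, hu, hv⟩

/-- Deleting an edge and adding an edge are inverse to each other. -/
theorem sum_darts_eq_sum_addable (h : SimpleGraph (Fin n) → Fin n × Fin n → ℝ) :
    ∑ G ∈ graphs n R, ∑ p ∈ darts G, h G p =
      ∑ G ∈ graphs n R, ∑ p ∈ addable R G, h (G ∆ SimpleGraph.edge p.1 p.2) p :=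
  sum_sum_involution (graphs n R) darts (addable R) (fun G p => G ∆ SimpleGraph.edge p.1 p.2)
    (fun _ _ => symmDiff_symmDiff_cancel_right _ _) (fun _ hG _ hp => symmDiff_edge_mem_of_mem_darts hG hp)
    (fun _ hG _ hp => symmDiff_edge_mem_of_mem_addable hG hp) h

/-! ### The triangle switching -/

/-- The triangle on three vertices. -/
def triangle (v x y : Fin n) : SimpleGraph (Fin n) :=
  SimpleGraph.edge v x ⊔ SimpleGraph.edge v y ⊔ SimpleGraph.edge x y

/-- Triples `(v, x, y)` where `v` has degree `d` and `xy` is an edge away from `v`. -/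
noncomputable def distantEdges (d : ℕ) (G : SimpleGraph (Fin n)) :
    Finset (Fin n × Fin n × Fin n) :=
  {t | G.degree t.1 = d ∧ (t.2.1 ≠ t.1 ∧ t.2.2 ≠ t.1) ∧
    G.Adj t.2.1 t.2.2 ∧ ¬ G.Adj t.1 t.2.1 ∧ ¬ G.Adj t.1 t.2.2}

/-- Triples `(v, x, y)` where `v` has degree `d` and `x`, `y` are two nonadjacent neighbours. -/
noncomputable def openWedges (d : ℕ) (G : SimpleGraph (Fin n)) :
    Finset (Fin n × Fin n × Fin n) :=
  {t | G.degree t.1 = d ∧ t.2.1 ≠ t.2.2 ∧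
    ¬ G.Adj t.2.1 t.2.2 ∧ G.Adj t.1 t.2.1 ∧ G.Adj t.1 t.2.2}

theorem symmDiff_triangle_adj {G : SimpleGraph (Fin n)} {v x y a b : Fin n} :
    (G ∆ triangle v x y).Adj a b ↔
      if (a = v ∨ a = x ∨ a = y) ∧ (b = v ∨ b = x ∨ b = y) ∧ a ≠ b then ¬ G.Adj a b
      else G.Adj a b := by
  have : (triangle v x y).Adj a b ↔
      (a = v ∨ a = x ∨ a = y) ∧ (b = v ∨ b = x ∨ b = y) ∧ a ≠ b := by
    simp only [triangle, SimpleGraph.sup_adj, SimpleGraph.edge_adj]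
    grind
  rw [symmDiff_adj, this]
  split_ifs with h <;> simp [h]

theorem degree_symmDiff_triangle_of_ne {G : SimpleGraph (Fin n)} {v x y w : Fin n} (hv : w ≠ v) (hx : w ≠ x) (hy : w ≠ y) :
    (G ∆ triangle v x y).degree w = G.degree w := by
  apply degree_congr
  intro z
  rw [symmDiff_triangle_adj]
  simp [hx, hy, hv]

theorem degree_symmDiff_triangle_apex {G : SimpleGraph (Fin n)} {v x y : Fin n} (hvx : v ≠ x)
    (hvy : v ≠ y) (hxy : x ≠ y) (h1 : ¬ G.Adj v x) (h2 : ¬ G.Adj v y) :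
    (G ∆ triangle v x y).degree v = G.degree v + 2 := by
  have : (G ∆ triangle v x y).neighborFinset v = insert x (insert y (G.neighborFinset v)) := by
    ext z
    by_cases hz : z = x
    · subst hz; simp [symmDiff_triangle_adj, *]
    by_cases hz' : z = y
    · subst hz'; simp [symmDiff_triangle_adj, *]
    simp only [SimpleGraph.mem_neighborFinset, mem_insert, hz, hz', false_or]
    rw [symmDiff_triangle_adj, if_neg]
    grind
  unfold SimpleGraph.degree
  rw [this, card_insert_of_notMem (by simp [h1, hxy]), card_insert_of_notMem (by simp [h2])]

/-- The vertex x loses the neighbour y and gains v, so the two changes cancel. -/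
theorem degree_symmDiff_triangle_base {G : SimpleGraph (Fin n)} {v x y : Fin n} (hvx : v ≠ x)
    (hvy : v ≠ y) (h : G.Adj x y) (h1 : ¬ G.Adj v x) :
    (G ∆ triangle v x y).degree x = G.degree x := by
  have hxy := h.ne
  have : (G ∆ triangle v x y).neighborFinset x = insert v ((G.neighborFinset x).erase y) := by
    ext z
    by_cases hz : z = v
    · subst hz
      simp [symmDiff_triangle_adj, *, hvx.symm]
      simpa [G.adj_comm] using h1
    by_cases hz' : z = y
    · subst hz'; simp [symmDiff_triangle_adj, *]
    simp only [SimpleGraph.mem_neighborFinset, mem_insert, mem_erase, hz, false_or]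
    rw [symmDiff_triangle_adj, if_neg]
    · simp [hz']
    · grind
  unfold SimpleGraph.degree
  rw [this, card_insert_of_notMem (by simp [G.adj_comm, h1]),
    card_erase_of_mem (by simpa using h)]
  have : 0 < #(G.neighborFinset x) := card_pos.2 ⟨y, by simpa using h⟩
  omega

theorem triangle_swap (v x y : Fin n) : triangle v y x = triangle v x y := by
  simp only [triangle, SimpleGraph.edge_comm y x]
  rw [sup_comm (SimpleGraph.edge v y)]

theorem degree_symmDiff_triangle {G : SimpleGraph (Fin n)} {d : ℕ} {t : Fin n × Fin n × Fin n}
    (ht : t ∈ distantEdges d G) (w : Fin n) :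
    (G ∆ triangle t.1 t.2.1 t.2.2).degree w = if w = t.1 then d + 2 else G.degree w := by
  obtain ⟨v, x, y⟩ := t
  simp only [distantEdges, mem_filter, mem_univ, true_and] at ht
  obtain ⟨hd, ⟨hx, hy⟩, hxy, h1, h2⟩ := ht
  split_ifs with hw
  · rw [hw, degree_symmDiff_triangle_apex hx.symm hy.symm hxy.ne h1 h2, hd]
  · by_cases hwx : w = x
    · subst hwx
      exact degree_symmDiff_triangle_base hx.symm hy.symm hxy h1
    by_cases hwy : w = y
    · subst hwy
      have := degree_symmDiff_triangle_base hy.symm hx.symm hxy.symm h2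
      rwa [triangle_swap] at this
    exact degree_symmDiff_triangle_of_ne hw hwx hwy

theorem mem_openWedges_symmDiff_triangle {G : SimpleGraph (Fin n)} {d : ℕ}
    {t : Fin n × Fin n × Fin n} (ht : t ∈ distantEdges d G) :
    t ∈ openWedges (d + 2) (G ∆ triangle t.1 t.2.1 t.2.2) := by
  have hdeg := degree_symmDiff_triangle ht t.1
  obtain ⟨v, x, y⟩ := t
  simp only [distantEdges, mem_filter, mem_univ, true_and] at ht
  obtain ⟨hd, ⟨hx, hy⟩, hxy, h1, h2⟩ := ht
  simp only [openWedges, mem_filter, mem_univ, true_and]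
  refine ⟨by simpa using hdeg, hxy.ne, ?_⟩
  simp only [symmDiff_triangle_adj]
  simp [hx.symm, hy.symm, hxy, hxy.ne, h1, h2]

theorem mem_distantEdges_symmDiff_triangle {G : SimpleGraph (Fin n)} {d : ℕ}
    {t : Fin n × Fin n × Fin n} (ht : t ∈ openWedges (d + 2) G) :
    t ∈ distantEdges d (G ∆ triangle t.1 t.2.1 t.2.2) := by
  obtain ⟨v, x, y⟩ := t
  simp only [openWedges, mem_filter, mem_univ, true_and] at ht
  obtain ⟨hd, hne, hxy, h1, h2⟩ := ht
  set G' := G ∆ triangle v x y with hG'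
  have hGG : G = G' ∆ triangle v x y := by simp [hG']
  have a1 : ¬ G'.Adj v x := by simp [hG', symmDiff_triangle_adj, h1, h1.ne]
  have a2 : ¬ G'.Adj v y := by simp [hG', symmDiff_triangle_adj, h2, h2.ne]
  have a3 : G'.Adj x y := by simp [hG', symmDiff_triangle_adj, hne, hxy]
  have := degree_symmDiff_triangle_apex h1.ne h2.ne hne a1 a2
  rw [← hGG, hd] at this
  simp only [distantEdges, mem_filter, mem_univ, true_and]
  exact ⟨by omega, ⟨h1.ne', h2.ne'⟩, a3, a1, a2⟩

/-- The triangle switching is a bijection. -/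
theorem sum_distantEdges_eq_sum_openWedges {d : ℕ} (hd : d + 2 ≤ R)
    (h : SimpleGraph (Fin n) → ℝ) :
    ∑ G ∈ graphs n R, ∑ _t ∈ distantEdges d G, h G =
      ∑ G ∈ graphs n R, ∑ t ∈ openWedges (d + 2) G, h (G ∆ triangle t.1 t.2.1 t.2.2) := by
  refine sum_sum_involution (graphs n R) (distantEdges d) (openWedges (d + 2))
    (fun G t => G ∆ triangle t.1 t.2.1 t.2.2) (fun _ _ => symmDiff_symmDiff_cancel_right _ _)
    (fun G hG t ht => ?_) (fun G hG t ht => ?_) (fun G _ => h G)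
  · refine ⟨mem_graphs.2 fun w => ?_, mem_openWedges_symmDiff_triangle ht⟩
    rw [degree_symmDiff_triangle ht]
    split_ifs
    · exact hd
    · exact mem_graphs.1 hG w
  · have ht' := mem_distantEdges_symmDiff_triangle ht
    refine ⟨mem_graphs.2 fun w => ?_, ht'⟩
    by_cases hw : w = t.1
    · have := ht'
      simp only [distantEdges, mem_filter, mem_univ, true_and] at this
      rw [hw, this.1]
      omega
    · have := degree_symmDiff_triangle ht' w
      rw [if_neg hw, symmDiff_symmDiff_cancel_right] at this
      rw [← this]
      exact mem_graphs.1 hG w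

/-- Only the apex changes degree, dropping from d+2 to d. This exact shift by one is what links
consecutive values of the count in the Poisson recurrence. -/
theorem numDegree_symmDiff_triangle {G : SimpleGraph (Fin n)} {d : ℕ}
    {t : Fin n × Fin n × Fin n} (ht : t ∈ openWedges (d + 2) G) :
    numDegree (G ∆ triangle t.1 t.2.1 t.2.2) d = numDegree G d + 1 := by
  have ht' := mem_distantEdges_symmDiff_triangle ht
  set G' := G ∆ triangle t.1 t.2.1 t.2.2 with hG'
  have hdeg := degree_symmDiff_triangle ht'
  have hGG : G = G' ∆ triangle t.1 t.2.1 t.2.2 := by simp [hG']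
  rw [← hGG] at hdeg
  have h0 : G'.degree t.1 = d := by
    simp only [distantEdges, mem_filter, mem_univ, true_and] at ht'
    exact ht'.1
  rw [numDegree_eq, numDegree_eq]
  have : (univ.filter fun v => G'.degree v = d) =
      insert t.1 (univ.filter fun v => G.degree v = d) := by
    ext w
    by_cases hw : w = t.1
    · simp [hw, h0]
    · simp [hw, hdeg]
  rw [this, card_insert_of_notMem]
  simp [hdeg]

/-! ### Counting bounds for a single graph -/

/-- The vertices of degree less than `R`. -/
noncomputable def deficient (R : ℕ) (G : SimpleGraph (Fin n)) : Finset (Fin n) :=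
  {v | G.degree v < R}

/-- The ordered triangles. -/
noncomputable def triangles (G : SimpleGraph (Fin n)) : Finset (Fin n × Fin n × Fin n) :=
  {t | G.Adj t.1 t.2.1 ∧ G.Adj t.1 t.2.2 ∧ G.Adj t.2.1 t.2.2}

theorem card_darts (G : SimpleGraph (Fin n)) : #(darts G) = ∑ v, G.degree v := by
  rw [card_eq_sum_card_fiberwise (f := Prod.fst) (t := univ) (by simp)]
  refine sum_congr rfl fun v _ => ?_
  refine card_nbij' Prod.snd (fun x => (v, x)) ?_ ?_ ?_ ?_
  · rintro ⟨a, b⟩ h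
    simp only [darts, coe_filter, mem_filter, mem_univ, true_and, Set.mem_ofPred_eq] at h
    simpa [← h.2] using h.1
  · intro x hx
    simpa [darts] using hx
  · rintro ⟨a, b⟩ h
    simp only [darts, coe_filter, mem_filter, mem_univ, true_and, Set.mem_ofPred_eq] at h
    simp [h.2]
  · intro x _
    rfl

theorem card_darts_le {G : SimpleGraph (Fin n)} (hG : G ∈ graphs n R) : #(darts G) ≤ R * n := by
  rw [card_darts]
  calc _ ≤ ∑ _v : Fin n, R := sum_le_sum fun v _ => mem_graphs.1 hG v
    _ = R * n := by simp [mul_comm]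

theorem le_card_darts (G : SimpleGraph (Fin n)) :
    R * n ≤ #(darts G) + R * #(deficient R G) := by
  rw [card_darts, deficient, card_filter, mul_sum, ← sum_add_distrib]
  calc R * n = ∑ _v : Fin n, R := by simp [mul_comm]
    _ ≤ _ := by
      refine sum_le_sum fun v _ => ?_
      split_ifs with h <;> omega

theorem card_addable_le (G : SimpleGraph (Fin n)) : #(addable R G) ≤ #(deficient R G) ^ 2 := by
  rw [sq, ← card_product]
  refine card_le_card fun p hp => ?_
  simp only [addable, mem_filter, mem_univ, true_and] at hp
  simp [deficient, hp.2.2]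

/-- For a fixed first vertex, at most R+1 second vertices are equal or adjacent to it; all other
pairs in W are addable. A general W is allowed so that it can be either all deficient vertices or
only those of degree R−1. -/
theorem sq_card_le {G : SimpleGraph (Fin n)} (hG : G ∈ graphs n R) {W : Finset (Fin n)}
    (hW : W ⊆ deficient R G) : #W ^ 2 ≤ #(addable R G) + (R + 1) * #W := by
  rw [sq, ← card_product]
  have hsub : W ×ˢ W ⊆ addable R G ∪
      (W ×ˢ W).filter fun p => p.2 ∈ insert p.1 (G.neighborFinset p.1) := by
    rintro ⟨a, b⟩ h
    have h' := h
    rw [mem_product] at h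
    have ha := hW h.1
    have hb := hW h.2
    simp only [deficient, mem_filter, mem_univ, true_and] at ha hb
    simp only [mem_union, addable, mem_filter, mem_univ, true_and, h', ha, hb, mem_insert,
      SimpleGraph.mem_neighborFinset]
    by_cases hab : a = b
    · simp [hab]
    · by_cases hadj : G.Adj a b <;> simp [hab, hadj]
  refine (card_le_card hsub).trans ((card_union_le _ _).trans (Nat.add_le_add_left ?_ _))
  refine card_le_mul_card_image_of_maps_to (f := Prod.fst) (fun p hp => ?_) (R + 1) fun b _ => ?_
  · exact (mem_product.1 (mem_filter.1 hp).1).1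
  · refine (card_le_card_of_injOn (t := insert b (G.neighborFinset b)) Prod.snd ?_ ?_).trans
      ((card_insert_le _ _).trans (Nat.add_le_add_right (mem_graphs.1 hG b) 1))
    · rintro ⟨x, y⟩ h
      simp only [coe_filter, mem_filter, Set.mem_ofPred_eq] at h
      obtain ⟨⟨_, h2⟩, rfl⟩ := h
      exact h2
    · rintro ⟨x, y⟩ h ⟨x', y'⟩ h' e
      simp only [coe_filter, Set.mem_ofPred_eq] at h h'
      simp_all

theorem numDegree_add_card_deficient {G : SimpleGraph (Fin n)} (hG : G ∈ graphs n R) :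
    numDegree G R + #(deficient R G) = n := by
  have := card_filter_add_card_filter_not (s := (univ : Finset (Fin n)))
    (fun v => G.degree v = R)
  rw [card_univ, Fintype.card_fin] at this
  rw [numDegree_eq]
  refine Eq.trans ?_ this
  rw [deficient]
  congr 2
  ext v
  simpa using ⟨fun h => h.ne, fun h => lt_of_le_of_ne (mem_graphs.1 hG v) h⟩

theorem numDegree_le_card_deficient {d : ℕ} (hd : d < R) (G : SimpleGraph (Fin n)) :
    numDegree G d ≤ #(deficient R G) := by
  rw [numDegree_eq]
  refine card_le_card fun v hv => ?_
  simp only [deficient, mem_filter, mem_univ, true_and] at hv ⊢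
  omega

/-- For a given v, a dart is lost only if one of its two ends lies in the closed neighbourhood of v:
at most R+1 places for that end, then at most R for the other. -/
theorem card_mul_darts_le {G : SimpleGraph (Fin n)} (hG : G ∈ graphs n R) (d : ℕ) :
    numDegree G d * #(darts G) ≤
      #(distantEdges d G) + numDegree G d * (2 * (R * (R + 1))) := by
  set U : Finset (Fin n) := univ.filter fun v => G.degree v = d with hU
  set B : Finset (Fin n × Fin n × Fin n) := univ.filter fun t => t.1 ∈ U ∧ G.Adj t.2.1 t.2.2 ∧
    t.2.1 ∈ insert t.1 (G.neighborFinset t.1) with hB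
  set B' : Finset (Fin n × Fin n × Fin n) := univ.filter fun t => t.1 ∈ U ∧ G.Adj t.2.1 t.2.2 ∧
    t.2.2 ∈ insert t.1 (G.neighborFinset t.1) with hB'
  set C : Finset (Fin n × Fin n) := univ.filter fun t => t.1 ∈ U ∧
    t.2 ∈ insert t.1 (G.neighborFinset t.1) with hC
  have hCcard : #C ≤ (R + 1) * #U := by
    refine card_le_mul_card_image_of_maps_to (f := Prod.fst) (fun p hp => ?_) (R + 1) fun b _ => ?_
    · exact (mem_filter.1 hp).2.1
    · refine (card_le_card_of_injOn (t := insert b (G.neighborFinset b)) Prod.snd ?_ ?_).trans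
        ((card_insert_le _ _).trans (Nat.add_le_add_right (mem_graphs.1 hG b) 1))
      · rintro ⟨x, y⟩ h
        simp only [hC, coe_filter, mem_filter, Set.mem_ofPred_eq] at h
        obtain ⟨⟨_, _, h2⟩, rfl⟩ := h
        exact h2
      · rintro ⟨x, y⟩ h ⟨x', y'⟩ h' e
        simp only [coe_filter, Set.mem_ofPred_eq] at h h'
        simp_all
  have hBcard : #B ≤ R * #C := by
    refine card_le_mul_card_image_of_maps_to (f := fun t => (t.1, t.2.1)) (fun p hp => ?_) R
      fun b _ => ?_
    · have := (mem_filter.1 hp).2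
      exact mem_filter.2 ⟨mem_univ _, this.1, this.2.2⟩
    · refine (card_le_card_of_injOn (t := G.neighborFinset b.2) (fun t => t.2.2) ?_ ?_).trans
        (mem_graphs.1 hG b.2)
      · rintro ⟨x, y, z⟩ h
        simp only [hB, coe_filter, mem_filter, Set.mem_ofPred_eq] at h
        obtain ⟨⟨_, _, h2, _⟩, rfl⟩ := h
        simpa using h2
      · rintro ⟨x, y, z⟩ h ⟨x', y', z'⟩ h' e
        simp only [coe_filter, Set.mem_ofPred_eq] at h h'
        obtain ⟨_, rfl⟩ := h
        simp_all
  have hBcard' : #B' ≤ R * #C := by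
    refine card_le_mul_card_image_of_maps_to (f := fun t => (t.1, t.2.2)) (fun p hp => ?_) R
      fun b _ => ?_
    · have := (mem_filter.1 hp).2
      exact mem_filter.2 ⟨mem_univ _, this.1, this.2.2⟩
    · refine (card_le_card_of_injOn (t := G.neighborFinset b.2) (fun t => t.2.1) ?_ ?_).trans
        (mem_graphs.1 hG b.2)
      · rintro ⟨x, y, z⟩ h
        simp only [hB', coe_filter, mem_filter, Set.mem_ofPred_eq] at h
        obtain ⟨⟨_, _, h2, _⟩, rfl⟩ := h
        simpa using h2.symm
      · rintro ⟨x, y, z⟩ h ⟨x', y', z'⟩ h' e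
        simp only [coe_filter, Set.mem_ofPred_eq] at h h'
        obtain ⟨_, rfl⟩ := h
        simp_all
  have hsub : U ×ˢ darts G ⊆ distantEdges d G ∪ (B ∪ B') := by
    rintro ⟨v, x, y⟩ h
    simp only [mem_product, hU, darts, mem_filter, mem_univ, true_and] at h
    simp only [mem_union, distantEdges, hB, hB', hU, mem_filter, mem_univ, true_and, mem_insert,
      SimpleGraph.mem_neighborFinset, h]
    tauto
  have h1 := card_le_card hsub
  rw [card_product] at h1
  have h2 := (card_union_le (distantEdges d G) (B ∪ B'))
  have h3 := card_union_le B B'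
  rw [numDegree_eq]
  calc #U * #(darts G) ≤ #(distantEdges d G) + (R * #C + R * #C) := by omega
    _ ≤ #(distantEdges d G) + (R * ((R + 1) * #U) + R * ((R + 1) * #U)) := by gcongr
    _ = _ := by ring

theorem card_distantEdges_le (G : SimpleGraph (Fin n)) (d : ℕ) :
    #(distantEdges d G) ≤ numDegree G d * #(darts G) := by
  rw [numDegree_eq, ← card_product]
  refine card_le_card fun t ht => ?_
  simp only [distantEdges, mem_filter, mem_univ, true_and] at ht
  simp [darts, ht]

theorem card_openWedges_le (G : SimpleGraph (Fin n)) (d : ℕ) :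
    #(openWedges d G) ≤ (d * d - d) * numDegree G d := by
  rw [numDegree_eq]
  refine card_le_mul_card_image_of_maps_to (f := Prod.fst) (fun t ht => ?_) _ fun b hb => ?_
  · simp only [openWedges, mem_filter, mem_univ, true_and] at ht
    simp [ht]
  · simp only [mem_filter, mem_univ, true_and] at hb
    have hoff : #((G.neighborFinset b).offDiag) = d * d - d := by
      rw [offDiag_card, SimpleGraph.card_neighborFinset_eq_degree, hb]
    rw [← hoff]
    refine card_le_card_of_injOn Prod.snd ?_ ?_
    · rintro ⟨x, y, z⟩ h
      simp only [openWedges, coe_filter, mem_filter, mem_univ, true_and, Set.mem_ofPred_eq] at h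
      obtain ⟨⟨_, h1, _, h2⟩, rfl⟩ := h
      simpa [h1] using h2
    · rintro ⟨x, y⟩ h ⟨x', y'⟩ h' e
      simp only [coe_filter, Set.mem_ofPred_eq] at h h'
      simp_all

/-- An ordered pair of distinct neighbours of v either spans an open wedge or closes a triangle. -/
theorem le_card_openWedges (G : SimpleGraph (Fin n)) (d : ℕ) :
    (d * d - d) * numDegree G d ≤ #(openWedges d G) + #(triangles G) := by
  rw [numDegree_eq]
  have h1 : #((univ.filter fun v => G.degree v = d).sigma fun v => (G.neighborFinset v).offDiag) =
      (d * d - d) * #(univ.filter fun v => G.degree v = d) := by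
    rw [card_sigma, sum_const_nat (m := d * d - d), mul_comm]
    intro v hv
    rw [offDiag_card, SimpleGraph.card_neighborFinset_eq_degree, (mem_filter.1 hv).2]
  rw [← h1]
  refine le_trans ?_ (card_union_le _ _)
  refine card_le_card_of_injOn (fun t => (t.1, t.2)) ?_ ?_
  · rintro ⟨v, x, y⟩ h
    simp only [coe_sigma, Set.mem_sigma_iff, mem_coe, mem_filter, mem_univ, true_and, mem_offDiag,
      SimpleGraph.mem_neighborFinset] at h
    obtain ⟨hv, hx, hy, hxy⟩ := h
    simp only [coe_union, Set.mem_union, mem_coe, openWedges, triangles, mem_filter, mem_univ,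
      true_and]
    by_cases h : G.Adj x y
    · exact Or.inr ⟨hx, hy, h⟩
    · exact Or.inl ⟨hv, hxy, h, hx, hy⟩
  · rintro ⟨v, x⟩ _ ⟨v', x'⟩ _ h
    simp only [Prod.mk.injEq] at h
    obtain ⟨rfl, rfl⟩ := h
    rfl

/-- The common neighbours of a pair. -/
noncomputable def commonNbrs (G : SimpleGraph (Fin n)) (p : Fin n × Fin n) : Finset (Fin n) :=
  {z | G.Adj z p.1 ∧ G.Adj z p.2}

/-- This writes triangles as a sum over darts, the form to which edge toggling applies. -/
theorem card_triangles (G : SimpleGraph (Fin n)) :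
    #(triangles G) = ∑ p ∈ darts G, #(commonNbrs G p) := by
  rw [card_eq_sum_card_fiberwise (f := Prod.snd) (t := darts G)]
  · refine sum_congr rfl fun p hp => ?_
    simp only [darts, mem_filter, mem_univ, true_and] at hp
    refine card_nbij' Prod.fst (fun x => (x, p)) ?_ ?_ ?_ ?_
    · rintro ⟨a, b⟩ h
      simp only [triangles, coe_filter, mem_filter, mem_univ, true_and, Set.mem_ofPred_eq] at h
      obtain ⟨h, rfl⟩ := h
      simpa [commonNbrs] using ⟨h.1, h.2.1⟩
    · intro x hx
      simp only [commonNbrs, coe_filter, mem_univ, true_and, Set.mem_ofPred_eq] at hx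
      simp [triangles, hx, hp]
    · rintro ⟨a, b⟩ h
      simp only [coe_filter, Set.mem_ofPred_eq] at h
      simp [h.2]
    · intro x _
      rfl
  · rintro ⟨v, x, y⟩ h
    simp only [triangles, coe_filter, mem_univ, true_and, Set.mem_ofPred_eq] at h
    simp [darts, h]

/-- A common neighbour is distinct from both ends of the pair, so its adjacencies to them are not
toggled. -/
theorem commonNbrs_symmDiff_edge (G : SimpleGraph (Fin n)) {p : Fin n × Fin n}
    (hp : p ∈ addable R G) :
    commonNbrs (G ∆ SimpleGraph.edge p.1 p.2) p = commonNbrs G p := by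
  obtain ⟨u, v⟩ := p
  simp only [addable, mem_filter, mem_univ, true_and] at hp
  ext z
  simp only [commonNbrs, mem_filter, mem_univ, true_and, symmDiff_edge_adj hp.1]
  have := hp.1
  by_cases h1 : z = u
  · subst h1; simp [this]
  by_cases h2 : z = v
  · subst h2; simp [h1, hp.2.1]
  simp [h1, h2]

/-- Each term is a path of length two starting at a deficient vertex, with at most R choices for
each step. -/
theorem sum_card_commonNbrs_le {G : SimpleGraph (Fin n)} (hG : G ∈ graphs n R) :
    ∑ p ∈ addable R G, #(commonNbrs G p) ≤ R ^ 2 * #(deficient R G) := by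
  have hdeg := mem_graphs.1 hG
  rw [← card_sigma]
  calc #((addable R G).sigma fun p => commonNbrs G p)
      ≤ #((deficient R G).sigma fun u => (G.neighborFinset u).sigma fun z =>
          G.neighborFinset z) := by
        refine card_le_card_of_injOn (fun t => ⟨t.1.1, t.2, t.1.2⟩) ?_ ?_
        · rintro ⟨⟨u, v⟩, z⟩ h
          simp only [coe_sigma, Set.mem_sigma_iff, mem_coe, addable, commonNbrs, mem_filter,
            mem_univ, true_and] at h
          simp only [coe_sigma, Set.mem_sigma_iff, mem_coe, deficient, mem_filter, mem_univ,
            true_and, SimpleGraph.mem_neighborFinset]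
          exact ⟨h.1.2.2.1, h.2.1.symm, h.2.2⟩
        · rintro ⟨⟨u, v⟩, z⟩ _ ⟨⟨u', v'⟩, z'⟩ _ h
          simp at h
          simp [h]
    _ ≤ ∑ u ∈ deficient R G, R ^ 2 := by
        rw [card_sigma]
        refine sum_le_sum fun u _ => ?_
        rw [card_sigma]
        calc _ ≤ ∑ z ∈ G.neighborFinset u, R := sum_le_sum fun z _ => hdeg z
          _ = #(G.neighborFinset u) * R := by simp
          _ ≤ R * R := Nat.mul_le_mul_right _ (hdeg u)
          _ = R ^ 2 := by ring
    _ = _ := by simp [mul_comm]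

/-- Adding an edge changes the degree of two vertices only. -/
theorem abs_card_symmDiff_edge_sub_le (G : SimpleGraph (Fin n)) {p : Fin n × Fin n}
    (hp : p.1 ≠ p.2) (Q : ℕ → Prop) [DecidablePred Q] :
    |(#{w | Q ((G ∆ SimpleGraph.edge p.1 p.2).degree w)} : ℝ) - (#{w | Q (G.degree w)} : ℝ)| ≤
      2 := by
  set G' := G ∆ SimpleGraph.edge p.1 p.2 with hG'
  have key : ∀ w, w ∉ ({p.1, p.2} : Finset (Fin n)) → G'.degree w = G.degree w := by
    intro w hw
    simp only [mem_insert, mem_singleton, not_or] at hw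
    exact degree_symmDiff_edge_of_ne hp hw.1 hw.2
  have hc : #({p.1, p.2} : Finset (Fin n)) ≤ 2 := card_le_two
  have h1 : #{w | Q (G'.degree w)} ≤ #{w | Q (G.degree w)} + 2 := by
    refine le_trans (card_le_card (t := univ.filter (fun w => Q (G.degree w)) ∪ {p.1, p.2}) fun w hw => ?_)
      ((card_union_le _ _).trans (Nat.add_le_add_left hc _))
    by_cases h : w ∈ ({p.1, p.2} : Finset (Fin n))
    · exact mem_union_right _ h
    · exact mem_union_left _ (by simpa [key w h] using hw)
  have h2 : #{w | Q (G.degree w)} ≤ #{w | Q (G'.degree w)} + 2 := by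
    refine le_trans (card_le_card (t := univ.filter (fun w => Q (G'.degree w)) ∪ {p.1, p.2}) fun w hw => ?_)
      ((card_union_le _ _).trans (Nat.add_le_add_left hc _))
    by_cases h : w ∈ ({p.1, p.2} : Finset (Fin n))
    · exact mem_union_right _ h
    · exact mem_union_left _ (by simpa [key w h] using hw)
  have h1' : (#{w | Q (G'.degree w)} : ℝ) ≤ #{w | Q (G.degree w)} + 2 := by exact_mod_cast h1
  have h2' : (#{w | Q (G.degree w)} : ℝ) ≤ #{w | Q (G'.degree w)} + 2 := by exact_mod_cast h2
  rw [abs_le]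
  constructor <;> linarith

/-! ### Averages over the graphs of bounded degree -/

/-- The expectation of `f` at a uniformly random member of `graphs n R`. -/
noncomputable def avg (n R : ℕ) (f : SimpleGraph (Fin n) → ℝ) : ℝ :=
  (∑ G ∈ graphs n R, f G) / #(graphs n R)

theorem card_graphs_pos (n R : ℕ) : (0 : ℝ) < #(graphs n R) := by
  exact_mod_cast card_pos.2 (graphs_nonempty n R)

theorem avg_mono {f g : SimpleGraph (Fin n) → ℝ} (h : ∀ G ∈ graphs n R, f G ≤ g G) :
    avg n R f ≤ avg n R g :=
  div_le_div_of_nonneg_right (sum_le_sum h) (card_graphs_pos n R).le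

theorem avg_congr {f g : SimpleGraph (Fin n) → ℝ} (h : ∀ G ∈ graphs n R, f G = g G) :
    avg n R f = avg n R g := by
  rw [avg, avg, sum_congr rfl h]

theorem avg_add (f g : SimpleGraph (Fin n) → ℝ) :
    avg n R (fun G => f G + g G) = avg n R f + avg n R g := by
  simp only [avg, sum_add_distrib, add_div]

theorem avg_sub (f g : SimpleGraph (Fin n) → ℝ) :
    avg n R (fun G => f G - g G) = avg n R f - avg n R g := by
  simp only [avg, sum_sub_distrib, sub_div]

theorem avg_const_mul (c : ℝ) (f : SimpleGraph (Fin n) → ℝ) :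
    avg n R (fun G => c * f G) = c * avg n R f := by
  simp only [avg, ← mul_sum, mul_div_assoc]

theorem avg_const (c : ℝ) : avg n R (fun _ => c) = c := by
  simp only [avg, sum_const, nsmul_eq_mul]
  exact mul_div_cancel_left₀ _ (card_graphs_pos n R).ne'

theorem avg_nonneg {f : SimpleGraph (Fin n) → ℝ} (h : ∀ G ∈ graphs n R, 0 ≤ f G) :
    0 ≤ avg n R f :=
  div_nonneg (sum_nonneg h) (card_graphs_pos n R).le

theorem abs_avg_le (f : SimpleGraph (Fin n) → ℝ) : |avg n R f| ≤ avg n R fun G => |f G| := by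
  rw [avg, abs_div, abs_of_pos (card_graphs_pos n R)]
  exact div_le_div_of_nonneg_right (abs_sum_le_sum_abs _ _) (card_graphs_pos n R).le

theorem avg_finset_sum {ι : Type*} (s : Finset ι) (f : ι → SimpleGraph (Fin n) → ℝ) :
    avg n R (fun G => ∑ i ∈ s, f i G) = ∑ i ∈ s, avg n R (f i) := by
  simp only [avg]
  rw [sum_comm, sum_div]

theorem proportion_eq_avg (P : SimpleGraph (Fin n) → Prop) :
    proportion n R P = avg n R fun G => if P G then 1 else 0 := by
  unfold proportion avg
  congr 1
  rw [sum_boole]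

theorem proportion_nonneg (P : SimpleGraph (Fin n) → Prop) : 0 ≤ proportion n R P := by
  rw [proportion_eq_avg]
  exact avg_nonneg fun G _ => by split_ifs <;> norm_num

theorem proportion_add_not (P : SimpleGraph (Fin n) → Prop) :
    proportion n R P + proportion n R (fun G => ¬ P G) = 1 := by
  rw [proportion_eq_avg, proportion_eq_avg, ← avg_add]
  refine (avg_congr (g := fun _ => 1) fun G _ => ?_).trans (avg_const 1)
  by_cases h : P G <;> simp [h]

theorem proportion_le_add {P Q S : SimpleGraph (Fin n) → Prop}
    (h : ∀ G ∈ graphs n R, P G → Q G ∨ S G) :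
    proportion n R P ≤ proportion n R Q + proportion n R S := by
  simp only [proportion_eq_avg]
  rw [← avg_add]
  refine avg_mono fun G hG => ?_
  have := h G hG
  by_cases h1 : P G <;> by_cases h2 : Q G <;> by_cases h3 : S G <;> simp_all

/-! ### Expectation identities and bounds -/

theorem avg_card_addable : avg n R (fun G => (#(addable R G) : ℝ)) =
    avg n R fun G => (#(darts G) : ℝ) := by
  have := sum_darts_eq_sum_addable (n := n) (R := R) fun _ _ => (1 : ℝ)
  simp only [sum_const, nsmul_eq_mul, mul_one] at this
  rw [avg, avg, this]

theorem avg_card_darts_le : avg n R (fun G => (#(darts G) : ℝ)) ≤ R * n := by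
  rw [← avg_const (n := n) (R := R) (R * n : ℝ)]
  exact avg_mono fun G hG => by exact_mod_cast card_darts_le hG

/-- If `h` changes little when an edge is added, then the numbers of addable pairs and of darts are
almost equal against the weight `h`. -/
theorem abs_avg_addable_sub_darts_mul_le {h : SimpleGraph (Fin n) → ℝ} {δ : ℝ}
    (hh : ∀ G ∈ graphs n R, ∀ p ∈ addable R G,
      |h (G ∆ SimpleGraph.edge p.1 p.2) - h G| ≤ δ) (hδ : 0 ≤ δ) :
    |avg n R fun G => ((#(addable R G) : ℝ) - #(darts G)) * h G| ≤ δ * (R * n) := by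
  have h1 : avg n R (fun G => (#(darts G) : ℝ) * h G) =
      avg n R fun G => ∑ p ∈ addable R G, h (G ∆ SimpleGraph.edge p.1 p.2) := by
    have := sum_darts_eq_sum_addable (n := n) (R := R) fun G _ => h G
    rw [avg, avg, ← this]
    simp
  have h2 : avg n R (fun G => ((#(addable R G) : ℝ) - #(darts G)) * h G) =
      avg n R fun G => ∑ p ∈ addable R G, (h G - h (G ∆ SimpleGraph.edge p.1 p.2)) := by
    simp only [sub_mul, avg_sub, h1, sum_sub_distrib, sum_const, nsmul_eq_mul]
  rw [h2]
  calc _ ≤ avg n R fun G => |∑ p ∈ addable R G, (h G - h (G ∆ SimpleGraph.edge p.1 p.2))| :=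
        abs_avg_le _
    _ ≤ avg n R fun G => δ * #(addable R G) := by
        refine avg_mono fun G hG => (abs_sum_le_sum_abs _ _).trans ?_
        calc _ ≤ ∑ _p ∈ addable R G, δ :=
              sum_le_sum fun p hp => by rw [abs_sub_comm]; exact hh G hG p hp
          _ = _ := by simp [mul_comm]
    _ ≤ δ * (R * n) := by
        rw [avg_const_mul, avg_card_addable]
        exact mul_le_mul_of_nonneg_left avg_card_darts_le hδ

theorem avg_sq_card_deficient_le :
    avg n R (fun G => (#(deficient R G) : ℝ) ^ 2) ≤ 2 * R * n + (R + 1) ^ 2 := by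
  have h : avg n R (fun G => (#(deficient R G) : ℝ) ^ 2) ≤
      avg n R fun G => #(addable R G) +
        (1 / 2 * (#(deficient R G) : ℝ) ^ 2 + (R + 1) ^ 2 / 2) := by
    refine avg_mono fun G hG => ?_
    have := sq_card_le hG (subset_refl (deficient R G))
    have : (#(deficient R G) : ℝ) ^ 2 ≤ #(addable R G) + (R + 1) * #(deficient R G) := by
      exact_mod_cast this
    -- The linear term (R+1)D is absorbed by D²/2 + (R+1)²/2.
    nlinarith [sq_nonneg ((#(deficient R G) : ℝ) - (R + 1))]
  rw [avg_add, avg_add, avg_const, avg_const_mul, avg_card_addable] at h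
  linarith [avg_card_darts_le (n := n) (R := R)]

theorem avg_card_deficient_le (hn : 1 ≤ n) :
    avg n R (fun G => (#(deficient R G) : ℝ)) ≤ (2 * R + (R + 1) ^ 2 + 1) * √n := by
  have hn' : (1 : ℝ) ≤ n := by exact_mod_cast hn
  have hs : 0 < √(n : ℝ) := Real.sqrt_pos.2 (by linarith)
  have hss : √(n : ℝ) * √n = n := Real.mul_self_sqrt (by linarith)
  -- The inequality 2√n·D ≤ D² + n turns the second-moment bound into a first-moment bound of order
  -- √n.
  have h : avg n R (fun G => 2 * √(n : ℝ) * (#(deficient R G) : ℝ)) ≤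
      avg n R fun G => (#(deficient R G) : ℝ) ^ 2 + n := by
    refine avg_mono fun G _ => ?_
    nlinarith [sq_nonneg ((#(deficient R G) : ℝ) - √n)]
  rw [avg_add, avg_const, avg_const_mul] at h
  have h2 := avg_sq_card_deficient_le (n := n) (R := R)
  have h3 : ((R : ℝ) + 1) ^ 2 ≤ (R + 1) ^ 2 * n := le_mul_of_one_le_right (by positivity) hn'
  have h4 : 0 ≤ (2 * (R : ℝ) + (R + 1) ^ 2 + 1) * n := by positivity
  refine le_of_mul_le_mul_left ?_ hs
  nlinarith

/-- Deleting the edge opposite a vertex of a triangle leaves an addable pair with that vertex as a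
common neighbour, and such configurations are few. -/
theorem avg_card_triangles_le :
    avg n R (fun G => (#(triangles G) : ℝ)) ≤
      R ^ 2 * avg n R fun G => (#(deficient R G) : ℝ) := by
  have h := sum_darts_eq_sum_addable (n := n) (R := R) fun G p => (#(commonNbrs G p) : ℝ)
  have h1 : avg n R (fun G => (#(triangles G) : ℝ)) =
      avg n R fun G => ∑ p ∈ addable R G, (#(commonNbrs G p) : ℝ) := by
    rw [avg, avg]
    congr 1
    simp only [card_triangles, Nat.cast_sum]
    rw [h]
    refine sum_congr rfl fun G _ => sum_congr rfl fun p hp => ?_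
    rw [commonNbrs_symmDiff_edge G hp]
  rw [h1, ← avg_const_mul]
  exact avg_mono fun G hG => by exact_mod_cast sum_card_commonNbrs_le hG

theorem avg_card_distantEdges {d : ℕ} (hd : d + 2 ≤ R) :
    avg n R (fun G => (#(distantEdges d G) : ℝ)) =
      avg n R fun G => (#(openWedges (d + 2) G) : ℝ) := by
  have := sum_distantEdges_eq_sum_openWedges (n := n) hd fun _ => (1 : ℝ)
  simp only [sum_const, nsmul_eq_mul, mul_one] at this
  rw [avg, avg, this]

theorem avg_card_distantEdges_of_numDegree {d : ℕ} (hd : d + 2 ≤ R) (k : ℕ) :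
    avg n R (fun G => if numDegree G d = k + 1 then (#(distantEdges d G) : ℝ) else 0) =
      avg n R fun G => if numDegree G d = k then (#(openWedges (d + 2) G) : ℝ) else 0 := by
  have := sum_distantEdges_eq_sum_openWedges (n := n) hd
    fun G => if numDegree G d = k + 1 then (1 : ℝ) else 0
  rw [avg, avg]
  congr 1
  convert this using 2 with G _ G _
  · simp
  · rw [sum_congr rfl (g := fun _ => if numDegree G d = k then (1 : ℝ) else 0)]
    · simp
    · intro t ht
      rw [numDegree_symmDiff_triangle ht]
      simp

/-- Markov-type bound for the number of vertices of degree `d`. -/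
theorem proportion_le_numDegree_le {d : ℕ} (hd : d + 2 ≤ R) (hn : 8 * (R + 1) ≤ n) {K : ℝ}
    (hK : 0 < K) :
    proportion n R (fun G => K ≤ numDegree G d) ≤
      2 / n * avg n R (fun G => (#(deficient R G) : ℝ)) +
        4 / (R * n * K) * avg n R fun G => (#(openWedges (d + 2) G) : ℝ) := by
  have hR : (0 : ℝ) < R := by exact_mod_cast (by omega : 0 < R)
  have hn0 : (0 : ℝ) < n := by exact_mod_cast (by omega : 0 < n)
  have hn' : 8 * ((R : ℝ) + 1) ≤ n := by exact_mod_cast hn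
  rw [proportion_eq_avg, ← avg_card_distantEdges hd, ← avg_const_mul, ← avg_const_mul, ← avg_add]
  refine avg_mono fun G hG => ?_
  have h0 : 0 ≤ 2 / (n : ℝ) * #(deficient R G) := by positivity
  have h1 : 0 ≤ 4 / (R * n * K) * (#(distantEdges d G) : ℝ) := by positivity
  split_ifs with h
  · by_cases hs : (n : ℝ) ≤ 2 * #(deficient R G)
    · have : 1 ≤ 2 / (n : ℝ) * #(deficient R G) := by
        rw [div_mul_eq_mul_div, one_le_div hn0]; exact hs
      linarith
    · have a1 : (numDegree G d : ℝ) * #(darts G) ≤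
          #(distantEdges d G) + numDegree G d * (2 * (R * (R + 1))) := by
        exact_mod_cast card_mul_darts_le hG d
      have a2 : (R : ℝ) * n ≤ #(darts G) + R * #(deficient R G) := by
        exact_mod_cast le_card_darts G
      have a3 : (R : ℝ) * n / 4 ≤ #(darts G) - 2 * (R * (R + 1)) := by
        push Not at hs
        nlinarith
      have a4 : K * (R * n / 4) ≤ #(distantEdges d G) := by
        calc K * (R * n / 4) ≤ numDegree G d * (#(darts G) - 2 * (R * (R + 1))) :=
              mul_le_mul h a3 (by positivity) (by positivity)
          _ ≤ _ := by linarith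
      have : 1 ≤ 4 / (R * n * K) * (#(distantEdges d G) : ℝ) := by
        rw [div_mul_eq_mul_div, one_le_div (by positivity)]
        linarith
      linarith
  · linarith

/-! ### Asymptotics of the deficient vertices -/

theorem tendsto_const_mul_inv_sqrt (C : ℝ) :
    Tendsto (fun n : ℕ => C * (√(n : ℝ))⁻¹) atTop (𝓝 0) := by
  have := (tendsto_inv_atTop_zero.comp
    (Real.tendsto_sqrt_atTop.comp tendsto_natCast_atTop_atTop)).const_mul C
  rw [mul_zero] at this
  exact this

theorem tendsto_avg_card_deficient_div (R : ℕ) :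
    Tendsto (fun n : ℕ => avg n R (fun G => (#(deficient R G) : ℝ)) / n) atTop (𝓝 0) := by
  have hlim := tendsto_const_mul_inv_sqrt (2 * (R : ℝ) + (R + 1) ^ 2 + 1)
  refine tendsto_of_tendsto_of_tendsto_of_le_of_le' tendsto_const_nhds hlim ?_ ?_
  · exact Eventually.of_forall fun n => div_nonneg (avg_nonneg fun G _ => by positivity)
      (by positivity)
  · filter_upwards [eventually_ge_atTop 1] with n hn
    have hn' : (0 : ℝ) < n := by exact_mod_cast hn
    rw [div_le_iff₀ hn']
    refine (avg_card_deficient_le hn).trans (le_of_eq ?_)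
    have : (√(n : ℝ))⁻¹ * n = √n := by
      rw [inv_mul_eq_div, Real.div_sqrt]
    rw [mul_assoc, this]

theorem tendsto_avg_card_triangles_div (R : ℕ) :
    Tendsto (fun n : ℕ => avg n R (fun G => (#(triangles G) : ℝ)) / n) atTop (𝓝 0) := by
  have hlim := (tendsto_avg_card_deficient_div R).const_mul ((R : ℝ) ^ 2)
  rw [mul_zero] at hlim
  refine squeeze_zero (fun n => div_nonneg (avg_nonneg fun G _ => by positivity)
      (by positivity)) (fun n => ?_) hlim
  rw [← mul_div_assoc]
  exact div_le_div_of_nonneg_right avg_card_triangles_le (by positivity)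

theorem avg_card_openWedges_le :
    avg n R (fun G => (#(openWedges R G) : ℝ)) ≤ (R * R - R : ℕ) * n := by
  rw [← avg_const (n := n) (R := R) ((R * R - R : ℕ) * n : ℝ)]
  refine avg_mono fun G hG => ?_
  have h1 := card_openWedges_le G R
  have h2 := numDegree_add_card_deficient hG
  exact_mod_cast h1.trans (Nat.mul_le_mul_left _ (by omega))

theorem avg_card_openWedges_le_of_lt {d : ℕ} (hd : d < R) :
    avg n R (fun G => (#(openWedges d G) : ℝ)) ≤
      R * R * avg n R fun G => (#(deficient R G) : ℝ) := by
  rw [← avg_const_mul]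
  refine avg_mono fun G hG => ?_
  have h1 := card_openWedges_le G d
  have h2 := numDegree_le_card_deficient hd G
  have h3 : d * d - d ≤ R * R := (Nat.sub_le _ _).trans (Nat.mul_le_mul hd.le hd.le)
  exact_mod_cast h1.trans (Nat.mul_le_mul h3 h2)

/-- Since d+2 is still below R, apexes of open wedges are deficient, so the wedges number O(√n) on
average against a factor of order n in the Markov bound. -/
theorem tendsto_proportion_one_le_numDegree {d : ℕ} (hd : d + 2 < R) :
    Tendsto (fun n : ℕ => proportion n R fun G => (1 : ℝ) ≤ numDegree G d) atTop (𝓝 0) := by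
  have hlim := (tendsto_avg_card_deficient_div R).const_mul (2 + 4 * (R : ℝ))
  rw [mul_zero] at hlim
  refine tendsto_of_tendsto_of_tendsto_of_le_of_le' tendsto_const_nhds hlim
    (Eventually.of_forall fun n => proportion_nonneg _) ?_
  filter_upwards [eventually_ge_atTop (8 * (R + 1))] with n hn
  have hR : (0 : ℝ) < R := by exact_mod_cast (by omega : 0 < R)
  have hn0 : (0 : ℝ) < n := by exact_mod_cast (by omega : 0 < n)
  refine (proportion_le_numDegree_le hd.le hn one_pos).trans ?_
  have h := avg_card_openWedges_le_of_lt (n := n) hd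
  calc _ ≤ 2 / n * avg n R (fun G => (#(deficient R G) : ℝ)) + 4 / (R * n * 1) *
        (R * R * avg n R fun G => (#(deficient R G) : ℝ)) := by gcongr
    _ = _ := by field_simp

/-- A union bound over the finitely many degrees below R−2. For R ≤ 2 the truncated difference is 0
and the event is empty. -/
theorem tendsto_proportion_not_noDegreeLT (R : ℕ) :
    Tendsto (fun n : ℕ => proportion n R fun G => ¬ NoDegreeLT G (R - 2)) atTop (𝓝 0) := by
  have hlim : Tendsto (fun n : ℕ => ∑ d ∈ range (R - 2),
      proportion n R fun G => (1 : ℝ) ≤ numDegree G d) atTop (𝓝 0) := by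
    rw [← sum_const_zero (s := range (R - 2))]
    refine tendsto_finsetSum _ fun d hd => tendsto_proportion_one_le_numDegree ?_
    have := mem_range.1 hd
    omega
  refine squeeze_zero (fun n => proportion_nonneg _) (fun n => ?_) hlim
  simp only [proportion_eq_avg]
  rw [← avg_finset_sum]
  refine avg_mono fun G _ => ?_
  have hnn : ∀ d ∈ range (R - 2), (0 : ℝ) ≤ if (1 : ℝ) ≤ numDegree G d then 1 else 0 := by
    intro d _
    split_ifs <;> norm_num
  by_cases h : NoDegreeLT G (R - 2)
  · rw [if_neg (not_not.2 h)]
    exact sum_nonneg hnn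
  · rw [if_pos h]
    simp only [NoDegreeLT, not_forall, not_not] at h
    obtain ⟨v, hv⟩ := h
    have h1 : 1 ≤ numDegree G (G.degree v) := by
      rw [numDegree_eq]
      exact card_pos.2 ⟨v, by simp⟩
    have hmem : G.degree v ∈ range (R - 2) := by
      rw [mem_range]
      convert hv
    refine le_trans (le_of_eq ?_) (single_le_sum hnn hmem)
    rw [if_pos (by exact_mod_cast h1)]

/-! ### Concentration of the number of vertices of degree `R - 1` -/

/-- The piecewise linear function which is `0` up to `a` and `1` from `b` on. -/
noncomputable def ramp (a b x : ℝ) : ℝ := max (min ((x - a) / (b - a)) 1) 0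

theorem ramp_nonneg (a b x : ℝ) : 0 ≤ ramp a b x := le_max_right _ _

theorem ramp_le_one (a b x : ℝ) : ramp a b x ≤ 1 := max_le (min_le_right _ _) zero_le_one

theorem ramp_of_le {a b x : ℝ} (hab : a < b) (hx : x ≤ a) : ramp a b x = 0 :=
  max_eq_right ((min_le_left _ _).trans
    (div_nonpos_of_nonpos_of_nonneg (by linarith) (by linarith)))

theorem ramp_of_ge {a b x : ℝ} (hab : a < b) (hx : b ≤ x) : ramp a b x = 1 := by
  have : 1 ≤ (x - a) / (b - a) := by rw [one_le_div (by linarith)]; linarith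
  rw [ramp, min_eq_right this, max_eq_left zero_le_one]

theorem abs_ramp_sub_le {a b : ℝ} (hab : a < b) (x y : ℝ) :
    |ramp a b x - ramp a b y| ≤ |x - y| / (b - a) := by
  have h1 : |ramp a b x - ramp a b y| ≤ |min ((x - a) / (b - a)) 1 - min ((y - a) / (b - a)) 1| :=
    abs_max_sub_max_le_abs _ _ _
  refine h1.trans ((abs_min_sub_min_le_max _ _ _ _).trans (le_of_eq ?_))
  rw [sub_self, abs_zero, max_eq_left (abs_nonneg _), ← sub_div, abs_div,
    abs_of_pos (sub_pos.2 hab)]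
  congr 2
  ring

/-- A weight depending on the number of vertices with a given degree property through a ramp at
scale `√n` changes by `O(1 / √n)` when an edge is added. -/
theorem abs_ramp_symmDiff_edge_sub_le {a b : ℝ} (hab : a < b) (Q : ℕ → Prop)
    [DecidablePred Q]
    (G : SimpleGraph (Fin n)) {p : Fin n × Fin n} (hp : p ∈ addable R G) :
    |ramp a b (#{w | Q ((G ∆ SimpleGraph.edge p.1 p.2).degree w)} / √n) -
      ramp a b (#{w | Q (G.degree w)} / √n)| ≤ 2 / √n / (b - a) := by
  refine (abs_ramp_sub_le hab _ _).trans ?_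
  refine div_le_div_of_nonneg_right ?_ (by linarith)
  rw [← sub_div, abs_div, abs_of_nonneg (Real.sqrt_nonneg _)]
  refine div_le_div_of_nonneg_right ?_ (Real.sqrt_nonneg _)
  simp only [addable, mem_filter, mem_univ, true_and] at hp
  exact abs_card_symmDiff_edge_sub_le G hp.1 Q

/-- Where the ramp is nonzero, N_{R-1} exceeds a√n with a² > R, so addable pairs outnumber darts by
at least cn. As the weighted difference averages O(√n), the ramp itself averages O(1/√n). -/
theorem tendsto_proportion_numDegree_ge {a b : ℝ} (hR : 1 ≤ R) (ha : 0 < a) (hab : a < b)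
    (haR : R < a ^ 2) :
    Tendsto (fun n : ℕ => proportion n R fun G => b * √n ≤ numDegree G (R - 1)) atTop (𝓝 0) := by
  -- Half of the gap a² − R is kept as c; the other half pays for the linear error (R+1)N.
  set c := (a ^ 2 - R) / 2 with hc
  have hc0 : 0 < c := by rw [hc]; linarith
  refine tendsto_of_tendsto_of_tendsto_of_le_of_le' tendsto_const_nhds
    (tendsto_const_mul_inv_sqrt (2 / (b - a) * R / c))
    (Eventually.of_forall fun n => proportion_nonneg _) ?_
  have hlarge : ∀ᶠ n : ℕ in atTop, max ((R + 1) / a) (a * (R + 1) / c) ≤ √(n : ℝ) :=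
    (Real.tendsto_sqrt_atTop.comp tendsto_natCast_atTop_atTop).eventually_ge_atTop _
  filter_upwards [hlarge, eventually_ge_atTop 1] with n hn hn1
  have hn0 : (0 : ℝ) < n := by exact_mod_cast hn1
  have hs : 0 < √(n : ℝ) := Real.sqrt_pos.2 hn0
  have hss : √(n : ℝ) * √n = n := Real.mul_self_sqrt hn0.le
  have hn2 : (R : ℝ) + 1 ≤ √n * a := (div_le_iff₀ ha).1 ((le_max_left _ _).trans hn)
  have hn3 : a * ((R : ℝ) + 1) ≤ √n * c := (div_le_iff₀ hc0).1 ((le_max_right _ _).trans hn)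
  set h : SimpleGraph (Fin n) → ℝ := fun G => ramp a b (#{w | G.degree w = R - 1} / √n) with hh
  have hδ : 0 ≤ 2 / √(n : ℝ) / (b - a) := div_nonneg (by positivity) (by linarith)
  have key := abs_avg_addable_sub_darts_mul_le (n := n) (R := R) (h := h)
    (fun G _ p hp => abs_ramp_symmDiff_edge_sub_le hab (fun d => d = R - 1) G hp) hδ
  have h1 : avg n R (fun G => c * n * h G) ≤
      avg n R fun G => ((#(addable R G) : ℝ) - #(darts G)) * h G := by
    refine avg_mono fun G hG => ?_
    set N : ℝ := (#{w | G.degree w = R - 1} : ℝ) with hN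
    by_cases hx : N / √n ≤ a
    · have : h G = 0 := ramp_of_le hab hx
      simp [this]
    · refine mul_le_mul_of_nonneg_right ?_ (ramp_nonneg _ _ _)
      push Not at hx
      rw [lt_div_iff₀ hs] at hx
      have e1 : N ^ 2 ≤ #(addable R G) + (R + 1) * N := by
        have := sq_card_le hG (W := univ.filter fun w => G.degree w = R - 1) fun w hw => by
          simp only [deficient, mem_filter, mem_univ, true_and] at hw ⊢
          omega
        rw [hN]
        exact_mod_cast this
      have e2 : (#(darts G) : ℝ) ≤ R * n := by exact_mod_cast card_darts_le hG
      -- `hn2` makes the smaller second factor nonnegative, so the two factors can be compared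
      -- separately.
      have e3 : a * √n * (a * √n - (R + 1)) ≤ N * (N - (R + 1)) :=
        mul_le_mul hx.le (by linarith) (by linarith) (by linarith [mul_pos ha hs])
      have e4 : a * √n * (a * √n - (R + 1)) = a ^ 2 * n - a * (R + 1) * √n := by
        linear_combination a ^ 2 * hss
      have e5 : a * (R + 1) * √n ≤ c * n := by
        have e51 := mul_le_mul_of_nonneg_right hn3 hs.le
        have e52 : √(n : ℝ) * c * √n = c * n := by linear_combination c * hss
        linarith
      have e6 : a ^ 2 = 2 * c + R := by rw [hc]; ring
      rw [e6] at e4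
      nlinarith
  rw [avg_const_mul] at h1
  have h2 : proportion n R (fun G => b * √n ≤ numDegree G (R - 1)) ≤ avg n R h := by
    rw [proportion_eq_avg]
    refine avg_mono fun G _ => ?_
    split_ifs with hb
    · rw [numDegree_eq, ← le_div_iff₀ hs] at hb
      exact (ramp_of_ge hab hb).ge
    · exact ramp_nonneg _ _ _
  refine h2.trans ?_
  have h3 : c * n * avg n R h ≤ 2 / √n / (b - a) * (R * n) := h1.trans ((le_abs_self _).trans key)
  rw [← mul_le_mul_iff_right₀ (mul_pos hc0 hn0)]
  refine h3.trans (le_of_eq ?_)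
  have : b - a ≠ 0 := by linarith
  field_simp

/-- The mirror argument, with a decreasing weight. It concerns all deficient vertices because it
needs the upper bound D² on addable pairs, which degree R−1 alone does not supply. -/
theorem tendsto_proportion_card_deficient_le {a b : ℝ} (hab : a < b)
    (hbR : b ^ 2 < R) :
    Tendsto (fun n : ℕ => proportion n R fun G => (#(deficient R G) : ℝ) ≤ a * √n) atTop
      (𝓝 0) := by
  set c := (R - b ^ 2) / 2 with hc
  have hc0 : 0 < c := by rw [hc]; linarith
  refine tendsto_of_tendsto_of_tendsto_of_le_of_le' tendsto_const_nhds
    (tendsto_const_mul_inv_sqrt (2 / (b - a) * R / c))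
    (Eventually.of_forall fun n => proportion_nonneg _) ?_
  have hlarge : ∀ᶠ n : ℕ in atTop, R * b / c ≤ √(n : ℝ) :=
    (Real.tendsto_sqrt_atTop.comp tendsto_natCast_atTop_atTop).eventually_ge_atTop _
  filter_upwards [hlarge, eventually_ge_atTop 1] with n hn hn1
  have hn0 : (0 : ℝ) < n := by exact_mod_cast hn1
  have hs : 0 < √(n : ℝ) := Real.sqrt_pos.2 hn0
  have hss : √(n : ℝ) * √n = n := Real.mul_self_sqrt hn0.le
  have hn3 : R * b ≤ √n * c := (div_le_iff₀ hc0).1 hn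
  set h : SimpleGraph (Fin n) → ℝ := fun G => 1 - ramp a b (#{w | G.degree w < R} / √n) with hh
  have hδ : 0 ≤ 2 / √(n : ℝ) / (b - a) := div_nonneg (by positivity) (by linarith)
  have key := abs_avg_addable_sub_darts_mul_le (n := n) (R := R) (h := h)
    (fun G _ p hp => by
      simp only [hh, sub_sub_sub_cancel_left]
      rw [abs_sub_comm]
      exact abs_ramp_symmDiff_edge_sub_le hab (fun d => d < R) G hp) hδ
  have h1 : avg n R (fun G => c * n * h G) ≤
      avg n R fun G => (-1) * (((#(addable R G) : ℝ) - #(darts G)) * h G) := by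
    refine avg_mono fun G hG => ?_
    set N : ℝ := (#{w | G.degree w < R} : ℝ) with hN
    by_cases hx : b ≤ N / √n
    · have : h G = 0 := by
        simp only [hh, ← hN, ramp_of_ge hab hx, sub_self]
      simp [this]
    · rw [← mul_assoc]
      refine mul_le_mul_of_nonneg_right ?_ (sub_nonneg.2 (ramp_le_one _ _ _))
      push Not at hx
      rw [div_lt_iff₀ hs] at hx
      have hN0 : 0 ≤ N := by positivity
      have e1 : (#(addable R G) : ℝ) ≤ N ^ 2 := by
        rw [hN]
        exact_mod_cast card_addable_le (R := R) G
      have e2 : (R : ℝ) * n ≤ #(darts G) + R * N := by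
        rw [hN]
        exact_mod_cast le_card_darts (R := R) G
      have e3 : N ^ 2 ≤ b ^ 2 * n := by
        calc N ^ 2 ≤ (b * √n) ^ 2 := pow_le_pow_left₀ hN0 hx.le 2
          _ = b ^ 2 * n := by linear_combination b ^ 2 * hss
      have e4 : R * N ≤ c * n := by
        calc R * N ≤ R * (b * √n) := by gcongr
          _ = R * b * √n := by ring
          _ ≤ √n * c * √n := mul_le_mul_of_nonneg_right hn3 hs.le
          _ = c * n := by linear_combination c * hss
      have e6 : (R : ℝ) = 2 * c + b ^ 2 := by rw [hc]; ring
      have e7 : (R : ℝ) * n = 2 * (c * n) + b ^ 2 * n := by rw [e6]; ring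
      linarith
  rw [avg_const_mul, avg_const_mul] at h1
  have h2 : proportion n R (fun G => (#(deficient R G) : ℝ) ≤ a * √n) ≤ avg n R h := by
    rw [proportion_eq_avg]
    refine avg_mono fun G _ => ?_
    split_ifs with hb
    · rw [deficient, ← div_le_iff₀ hs] at hb
      simp only [hh]
      rw [ramp_of_le hab hb, sub_zero]
    · exact sub_nonneg.2 (ramp_le_one _ _ _)
  refine h2.trans ?_
  have h3 : c * n * avg n R h ≤ 2 / √n / (b - a) * (R * n) := by
    have := neg_le_of_abs_le key
    linarith
  rw [← mul_le_mul_iff_right₀ (mul_pos hc0 hn0)]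
  refine h3.trans (le_of_eq ?_)
  have : b - a ≠ 0 := by linarith
  field_simp

theorem proportion_le_numDegree_sub_two_le (hR : 2 ≤ R) (hn : 8 * (R + 1) ≤ n) {K : ℝ}
    (hK : 0 < K) :
    proportion n R (fun G => K ≤ numDegree G (R - 2)) ≤
      2 * (avg n R (fun G => (#(deficient R G) : ℝ)) / n) + 4 * (R - 1) / K := by
  have h := proportion_le_numDegree_le (d := R - 2) (by omega) hn hK
  rw [Nat.sub_add_cancel hR] at h
  have hR : (0 : ℝ) < R := by exact_mod_cast (by omega : 0 < R)
  have hn0 : (0 : ℝ) < n := by exact_mod_cast (by omega : 0 < n)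
  have h1 := avg_card_openWedges_le (n := n) (R := R)
  rw [Nat.cast_sub (Nat.le_mul_self R), Nat.cast_mul] at h1
  refine h.trans ?_
  calc _ ≤ 2 / n * avg n R (fun G => (#(deficient R G) : ℝ)) + 4 / (R * n * K) *
        ((R * R - R) * n) := by gcongr
    _ = _ := by field_simp

theorem card_deficient_le {G : SimpleGraph (Fin n)} (h : NoDegreeLT G (R - 2)) :
    #(deficient R G) ≤ numDegree G (R - 1) + numDegree G (R - 2) := by
  rw [numDegree_eq, numDegree_eq]
  refine le_trans (card_le_card fun v hv => ?_) (card_union_le _ _)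
  have h1 : ¬ G.degree v < R - 2 := by
    convert h v
  simp only [deficient, mem_filter, mem_univ, true_and, mem_union] at hv ⊢
  omega

/-- If N_{R-1} < a√n, then either D ≤ m√n, or some degree is below R−2, or N_{R-2} makes up the
missing (m−a)√n. Each case has vanishing probability. -/
theorem tendsto_proportion_numDegree_lt (hR : 2 ≤ R) {a b : ℝ} (hab : a < b)
    (hbR : b ^ 2 < R) :
    Tendsto (fun n : ℕ => proportion n R fun G => numDegree G (R - 1) < a * √n) atTop (𝓝 0) := by
  obtain ⟨m, ham, hmb⟩ := exists_between hab
  have hm : 0 < m - a := sub_pos.2 ham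
  have l1 := tendsto_proportion_card_deficient_le hmb hbR
  have l2 := tendsto_proportion_not_noDegreeLT R
  have l3 := (tendsto_avg_card_deficient_div R).const_mul 2
  have l4 := tendsto_const_mul_inv_sqrt (4 * ((R : ℝ) - 1) / (m - a))
  have l := l1.add (l2.add (l3.add l4))
  simp only [mul_zero, add_zero] at l
  refine tendsto_of_tendsto_of_tendsto_of_le_of_le' tendsto_const_nhds l
    (Eventually.of_forall fun n => proportion_nonneg _) ?_
  filter_upwards [eventually_ge_atTop (8 * (R + 1))] with n hn
  have hn0 : (0 : ℝ) < n := by exact_mod_cast (by omega : 0 < n)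
  have hs : 0 < √(n : ℝ) := Real.sqrt_pos.2 hn0
  have h3 := proportion_le_numDegree_sub_two_le hR hn (mul_pos hm hs)
  have h3' : 4 * ((R : ℝ) - 1) / ((m - a) * √n) = 4 * (R - 1) / (m - a) * (√(n : ℝ))⁻¹ := by
    field_simp
  rw [h3'] at h3
  refine le_trans (proportion_le_add (Q := fun G => (#(deficient R G) : ℝ) ≤ m * √n)
    (S := fun G => ¬ NoDegreeLT G (R - 2) ∨ (m - a) * √n ≤ numDegree G (R - 2)) ?_) ?_
  · intro G _ hG
    by_contra! hcon
    obtain ⟨c1, c2, c3⟩ := hcon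
    have : (#(deficient R G) : ℝ) ≤ numDegree G (R - 1) + numDegree G (R - 2) := by
      exact_mod_cast card_deficient_le c2
    nlinarith
  · refine add_le_add le_rfl (le_trans (proportion_le_add fun G _ h => h) ?_)
    exact add_le_add le_rfl h3

end BoundedDegree

/-- If `(k + 1) p (k + 1) - c p k → 0` for all `k` and the `p n` are asymptotically tight
probability distributions, then they converge to the Poisson distribution with mean `c`. -/
theorem tendsto_poisson_of_recurrence {p : ℕ → ℕ → ℝ} {c M : ℝ}
    (hp : ∀ n k, 0 ≤ p n k)
    (hrec : ∀ k : ℕ, Tendsto (fun n => (k + 1) * p n (k + 1) - c * p n k) atTop (𝓝 0))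
    (hle : ∀ n K, ∑ k ∈ range K, p n k ≤ 1) {t : ℕ → ℝ} (ht : Tendsto t atTop (𝓝 0))
    (htail : ∀ K : ℕ, 0 < K → ∀ᶠ n in atTop, 1 - t n - M / K ≤ ∑ k ∈ range K, p n k) (k : ℕ) :
    Tendsto (fun n => p n k) atTop (𝓝 (c ^ k * Real.exp (-c) / k.factorial)) := by
  -- Iterating the recurrence expresses each p n k through p n 0; only the normalisation is left to
  -- find.
  have hdiff : ∀ k : ℕ, Tendsto (fun n => p n k - c ^ k / k.factorial * p n 0) atTop (𝓝 0) := by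
    intro k
    induction k with
    | zero => simp
    | succ k ih =>
      have h := ((hrec k).add (ih.const_mul c)).const_mul ((k + 1 : ℝ)⁻¹)
      simp only [mul_zero, add_zero] at h
      refine h.congr fun n => ?_
      have h1 : (k + 1 : ℝ) ≠ 0 := by positivity
      have h2 : (k.factorial : ℝ) ≠ 0 := by positivity
      rw [Nat.factorial_succ]
      push_cast
      field_simp
      ring
  have hS : Tendsto (fun K : ℕ => ∑ k ∈ range K, c ^ k / k.factorial) atTop (𝓝 (Real.exp c)) := by
    have := (NormedSpace.expSeries_div_hasSum_exp (𝔸 := ℝ) c).tendsto_sum_nat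
    rwa [← Real.exp_eq_exp_ℝ] at this
  have hsum : ∀ K : ℕ, Tendsto (fun n => ∑ k ∈ range K, p n k -
      (∑ k ∈ range K, c ^ k / k.factorial) * p n 0) atTop (𝓝 0) := by
    intro K
    have := tendsto_finsetSum (range K) fun k _ => hdiff k
    rw [sum_const_zero] at this
    refine this.congr fun n => ?_
    rw [sum_sub_distrib, sum_mul]
  have hp1 : ∀ n, p n 0 ≤ 1 := fun n => by simpa using hle n 1
  have h0 : Tendsto (fun n => Real.exp c * p n 0) atTop (𝓝 1) := by
    rw [Metric.tendsto_atTop]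
    intro ε hε
    have hM : Tendsto (fun K : ℕ => M / (K : ℝ)) atTop (𝓝 0) :=
      tendsto_const_div_atTop_nhds_zero_nat M
    -- K is fixed before n. The four quarters of ε cover the tail M/K, the truncated exponential
    -- series, the recurrence error over k < K, and t n.
    obtain ⟨K, hK1, hK2, hK3⟩ := ((hM.eventually (gt_mem_nhds (by positivity : (0 : ℝ) < ε / 4))).and
      ((hS.eventually (Metric.ball_mem_nhds _ (by positivity : (0 : ℝ) < ε / 4))).and
        (eventually_gt_atTop 0))).exists
    rw [Real.dist_eq, abs_lt] at hK2
    have e1 := (hsum K).eventually (Metric.ball_mem_nhds _ (by positivity : (0 : ℝ) < ε / 4))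
    have e2 := ht.eventually (gt_mem_nhds (by positivity : (0 : ℝ) < ε / 4))
    rw [← eventually_atTop]
    filter_upwards [e1, e2, htail K hK3] with n h1 h2 h3
    rw [Real.dist_eq, abs_lt] at h1
    have h4 := hle n K
    have h5 := hp1 n
    have h6 := hp n 0
    set S := ∑ k ∈ range K, c ^ k / (k.factorial : ℝ)
    have h7 : |(Real.exp c - S) * p n 0| ≤ ε / 4 := by
      rw [abs_mul, abs_of_nonneg h6]
      calc _ ≤ ε / 4 * 1 := mul_le_mul (abs_le.2 ⟨by linarith, by linarith⟩) h5 h6 (by positivity)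
        _ = ε / 4 := mul_one _
    rw [abs_le, sub_mul] at h7
    rw [Real.dist_eq, abs_lt]
    constructor <;> linarith
  have h0' : Tendsto (fun n => p n 0) atTop (𝓝 (Real.exp (-c))) := by
    have := h0.const_mul (Real.exp (-c))
    rw [mul_one] at this
    refine this.congr fun n => ?_
    rw [← mul_assoc, ← Real.exp_add]
    simp
  have := (hdiff k).add (h0'.const_mul (c ^ k / k.factorial))
  rw [zero_add] at this
  convert this using 2
  · ring
  · ring

namespace BoundedDegree

variable {n R : ℕ}

/-! ### The Poisson limit -/

/-- The triangle switching equates distant edges on N_{R-2} = k+1 with open wedges on N_{R-2} = k.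
The former are (k+1)Rn per graph and the latter R(R−1)n, up to errors from deficient vertices, darts
near the apex and triangles; the difference is divided by Rn. -/
theorem abs_recurrence_le (hR : 2 ≤ R) (hn : 1 ≤ n) (k : ℕ) :
    |(k + 1) * proportion n R (fun G => numDegree G (R - 2) = k + 1) -
      (R - 1) * proportion n R (fun G => numDegree G (R - 2) = k)| ≤
    (k + 1) * (avg n R (fun G => (#(deficient R G) : ℝ)) / n + 2 * (R + 1) / n) +
      R * (avg n R (fun G => (#(deficient R G) : ℝ)) / n) +
        avg n R (fun G => (#(triangles G) : ℝ)) / n := by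
  have hR1 : (2 : ℝ) ≤ R := by exact_mod_cast hR
  have hn0 : (0 : ℝ) < n := by exact_mod_cast hn
  have hRR : ((R * R - R : ℕ) : ℝ) = R * (R - 1) := by
    rw [Nat.cast_sub (Nat.le_mul_self R), Nat.cast_mul]; ring
  have hid := avg_card_distantEdges_of_numDegree (n := n) (d := R - 2) (R := R) (by omega) k
  rw [Nat.sub_add_cancel hR] at hid
  set s := avg n R (fun G => (#(deficient R G) : ℝ)) with hs
  set T := avg n R (fun G => (#(triangles G) : ℝ)) with hT
  have f1 : avg n R (fun G => if numDegree G (R - 2) = k + 1 then (#(distantEdges (R - 2) G) : ℝ)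
      else 0) ≤ (k + 1) * (R * n) * proportion n R (fun G => numDegree G (R - 2) = k + 1) := by
    rw [proportion_eq_avg, ← avg_const_mul]
    refine avg_mono fun G hG => ?_
    split_ifs with h
    · have := (card_distantEdges_le G (R - 2)).trans (Nat.mul_le_mul_left _ (card_darts_le hG))
      rw [h] at this
      rw [mul_one]
      exact_mod_cast this
    · simp
  have f2 : (k + 1) * (R * n) * proportion n R (fun G => numDegree G (R - 2) = k + 1) ≤
      avg n R (fun G => if numDegree G (R - 2) = k + 1 then (#(distantEdges (R - 2) G) : ℝ)
      else 0) + (k + 1) * (R * s + 2 * (R * (R + 1))) := by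
    rw [proportion_eq_avg, ← avg_const_mul, hs, ← avg_const_mul,
      ← avg_const (n := n) (R := R) (2 * ((R : ℝ) * (R + 1))), ← avg_add, ← avg_const_mul,
      ← avg_add]
    refine avg_mono fun G hG => ?_
    split_ifs with h
    · have h1 := card_mul_darts_le hG (R - 2)
      rw [h] at h1
      have h1' : ((k : ℝ) + 1) * #(darts G) ≤
          #(distantEdges (R - 2) G) + (k + 1) * (2 * (R * (R + 1))) := by exact_mod_cast h1
      have h2 : (R : ℝ) * n ≤ #(darts G) + R * #(deficient R G) := by
        exact_mod_cast le_card_darts G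
      have h3 := mul_le_mul_of_nonneg_left h2 (by positivity : (0 : ℝ) ≤ k + 1)
      linarith
    · rw [mul_zero]
      positivity
  have g1 : avg n R (fun G => if numDegree G (R - 2) = k then (#(openWedges R G) : ℝ) else 0) ≤
      R * (R - 1) * n * proportion n R (fun G => numDegree G (R - 2) = k) := by
    rw [proportion_eq_avg, ← avg_const_mul]
    refine avg_mono fun G hG => ?_
    split_ifs with h
    · have h1 := card_openWedges_le G R
      have h2 := numDegree_add_card_deficient hG
      have h3 := h1.trans (Nat.mul_le_mul_left _ (by omega : numDegree G R ≤ n))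
      rw [mul_one, ← hRR]
      exact_mod_cast h3
    · simp
  have g2 : R * (R - 1) * n * proportion n R (fun G => numDegree G (R - 2) = k) ≤
      avg n R (fun G => if numDegree G (R - 2) = k then (#(openWedges R G) : ℝ) else 0) +
        (R * (R - 1) * s + T) := by
    rw [proportion_eq_avg, ← avg_const_mul, hs, hT, ← avg_const_mul, ← avg_add, ← avg_add]
    refine avg_mono fun G hG => ?_
    split_ifs with h
    · have h1 : ((R * R - R : ℕ) : ℝ) * numDegree G R ≤ #(openWedges R G) + #(triangles G) := by
        exact_mod_cast le_card_openWedges G R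
      have h2 : (numDegree G R : ℝ) + #(deficient R G) = n := by
        exact_mod_cast numDegree_add_card_deficient hG
      rw [hRR] at h1
      rw [← h2]
      linarith
    · have : (0 : ℝ) ≤ R * (R - 1) := mul_nonneg (by linarith) (by linarith)
      rw [mul_zero]
      positivity
  have hs0 : 0 ≤ s := avg_nonneg fun G _ => by positivity
  have hT0 : 0 ≤ T := avg_nonneg fun G _ => by positivity
  rw [← hid] at g1 g2
  set P := proportion n R (fun G => numDegree G (R - 2) = k + 1)
  set Q := proportion n R (fun G => numDegree G (R - 2) = k)
  have hRn : (0 : ℝ) < R * n := by positivity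
  have e1 : ((k + 1) * P - (R - 1) * Q) =
      ((k + 1) * (R * n) * P - R * (R - 1) * n * Q) / (R * n) := by
    field_simp
  have hk : (0 : ℝ) ≤ (k + 1) * (R * s + 2 * (R * (R + 1))) := by positivity
  have hr : (0 : ℝ) ≤ R * (R - 1) * s :=
    mul_nonneg (mul_nonneg (by linarith) (by linarith)) hs0
  have hr2 : R * (R - 1) * s ≤ R * R * s :=
    mul_le_mul_of_nonneg_right (mul_le_mul_of_nonneg_left (by linarith) (by linarith)) hs0
  have hT2 : T ≤ R * T := le_mul_of_one_le_left hT0 (by linarith)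
  rw [e1, abs_div, abs_of_pos hRn, div_le_iff₀ hRn]
  have e2 : ((k + 1) * (s / n + 2 * (R + 1) / n) + R * (s / n) + T / n) * (R * n) =
      (k + 1) * (R * s + 2 * (R * (R + 1))) + R * R * s + R * T := by
    field_simp
  rw [e2, abs_le]
  constructor <;> linarith

theorem tendsto_recurrence (hR : 2 ≤ R) (k : ℕ) :
    Tendsto (fun n : ℕ => (k + 1) * proportion n R (fun G => numDegree G (R - 2) = k + 1) -
      ((R : ℝ) - 1) * proportion n R (fun G => numDegree G (R - 2) = k)) atTop (𝓝 0) := by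
  have l1 := tendsto_avg_card_deficient_div R
  have l2 : Tendsto (fun n : ℕ => 2 * ((R : ℝ) + 1) / (n : ℝ)) atTop (𝓝 0) :=
    tendsto_const_div_atTop_nhds_zero_nat _
  have l := (((l1.add l2).const_mul ((k : ℝ) + 1)).add (l1.const_mul (R : ℝ))).add
    (tendsto_avg_card_triangles_div R)
  simp only [add_zero, mul_zero] at l
  refine squeeze_zero_norm' ?_ l
  filter_upwards [eventually_ge_atTop 1] with n hn
  exact abs_recurrence_le hR hn k

theorem sum_proportion_numDegree (d K : ℕ) :
    ∑ k ∈ range K, proportion n R (fun G => numDegree G d = k) =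
      1 - proportion n R (fun G => (K : ℝ) ≤ numDegree G d) := by
  rw [eq_sub_iff_add_eq]
  simp only [proportion_eq_avg]
  rw [← avg_finset_sum, ← avg_add]
  refine (avg_congr (g := fun _ => 1) fun G _ => ?_).trans (avg_const 1)
  by_cases h : K ≤ numDegree G d
  · refine (congrArg (· + _) (sum_eq_zero fun i hi => if_neg ?_)).trans ?_
    · have := mem_range.1 hi
      omega
    · simp [h]
  · refine (congrArg (· + _) (sum_eq_single_of_mem (numDegree G d) (mem_range.2 (not_le.1 h))
      fun i _ hi => if_neg hi.symm)).trans ?_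
    simp [h]

theorem tendsto_proportion_numDegree_eq (hR : 2 ≤ R) (k : ℕ) :
    Tendsto (fun n : ℕ => proportion n R fun G => numDegree G (R - 2) = k) atTop
      (𝓝 (((R : ℝ) - 1) ^ k * Real.exp (-((R : ℝ) - 1)) / k.factorial)) := by
  have hR1 : (2 : ℝ) ≤ R := by exact_mod_cast hR
  have l := (tendsto_avg_card_deficient_div R).const_mul 2
  rw [mul_zero] at l
  refine tendsto_poisson_of_recurrence
    (p := fun n k => proportion n R fun G => numDegree G (R - 2) = k) (M := 4 * ((R : ℝ) - 1))
    (fun _ _ => proportion_nonneg _) (tendsto_recurrence hR) (fun n K => ?_) l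
    (fun K hK => ?_) k
  · simp only [sum_proportion_numDegree]
    linarith [proportion_nonneg (n := n) (R := R) fun G => (K : ℝ) ≤ numDegree G (R - 2)]
  · filter_upwards [eventually_ge_atTop (8 * (R + 1))] with n hn
    simp only [sum_proportion_numDegree]
    linarith [proportion_le_numDegree_sub_two_le hR hn (K := K) (by exact_mod_cast hK)]

/-! ### Events of asymptotic probability one. -/

theorem tendsto_proportion_of_not {P : ∀ n, SimpleGraph (Fin n) → Prop}
    (h : Tendsto (fun n : ℕ => proportion n R fun G => ¬ P n G) atTop (𝓝 0)) :
    Tendsto (fun n : ℕ => proportion n R (P n)) atTop (𝓝 1) := by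
  have := h.const_sub 1
  rw [sub_zero] at this
  refine this.congr fun n => ?_
  linarith [proportion_add_not (n := n) (R := R) (P n)]

theorem tendsto_proportion_numDegree_sub_one (hR : 2 ≤ R) {ε : ℝ} (hε : 0 < ε) :
    Tendsto (fun n : ℕ => proportion n R fun G =>
      √(((R : ℝ) - ε) * n) ≤ numDegree G (R - 1) ∧
        (numDegree G (R - 1) : ℝ) ≤ √(((R : ℝ) + ε) * n)) atTop (𝓝 1) := by
  have hR1 : (2 : ℝ) ≤ R := by exact_mod_cast hR
  apply tendsto_proportion_of_not
  have hlow : Tendsto (fun n : ℕ => proportion n R fun G =>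
      numDegree G (R - 1) < √((R : ℝ) - ε) * √n) atTop (𝓝 0) := by
    -- When ε ≥ R the real square root is 0 by convention, and a count is never negative. Otherwise
    -- ε/2 leaves the room between a and b that the ramp needs.
    rcases le_or_gt (R : ℝ) ε with h | h
    · have h0 : √((R : ℝ) - ε) = 0 := Real.sqrt_eq_zero_of_nonpos (by linarith)
      have : ∀ n : ℕ, proportion n R (fun G => (numDegree G (R - 1) : ℝ) < √((R : ℝ) - ε) * √n) =
          0 := by
        intro n
        rw [proportion_eq_avg, h0]
        refine (avg_congr (g := fun _ => 0) fun G _ => ?_).trans (avg_const 0)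
        rw [zero_mul, if_neg (not_lt.2 (by positivity))]
      simp only [this]
      exact tendsto_const_nhds
    · refine tendsto_proportion_numDegree_lt hR (b := √((R : ℝ) - ε / 2)) ?_ ?_
      · exact Real.sqrt_lt_sqrt (by linarith) (by linarith)
      · rw [Real.sq_sqrt (by linarith)]
        linarith
  have hhigh := tendsto_proportion_numDegree_ge (R := R) (a := √((R : ℝ) + ε / 2))
    (b := √((R : ℝ) + ε)) (by omega) (Real.sqrt_pos.2 (by linarith))
    (Real.sqrt_lt_sqrt (by linarith) (by linarith))
    (by rw [Real.sq_sqrt (by linarith)]; linarith)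
  have l := hlow.add hhigh
  rw [add_zero] at l
  refine squeeze_zero (fun n => proportion_nonneg _) (fun n => proportion_le_add ?_) l
  intro G _ hG
  -- This form of the product rule needs only n ≥ 0, so R − ε may be negative.
  rw [Real.sqrt_mul' _ (by positivity), Real.sqrt_mul' _ (by positivity)] at hG
  by_contra! hcon
  exact hG ⟨hcon.1, hcon.2.le⟩

end BoundedDegree

end

theorem theorem2p1 (R : ℕ) (hR : 2 ≤ R) :
    Filter.Tendsto
        (fun n : ℕ => BoundedDegree.proportion n R fun G => BoundedDegree.NoDegreeLT G (R - 2))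
        Filter.atTop (nhds 1) ∧
      (∀ ε : ℝ, 0 < ε →
        Filter.Tendsto
          (fun n : ℕ => BoundedDegree.proportion n R fun G =>
            Real.sqrt (((R : ℝ) - ε) * (n : ℝ)) ≤ (BoundedDegree.numDegree G (R - 1) : ℝ) ∧
              (BoundedDegree.numDegree G (R - 1) : ℝ) ≤ Real.sqrt (((R : ℝ) + ε) * (n : ℝ)))
          Filter.atTop (nhds 1)) ∧
      ∀ k : ℕ,
        Filter.Tendsto
          (fun n : ℕ => BoundedDegree.proportion n R fun G =>
            BoundedDegree.numDegree G (R - 2) = k)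
          Filter.atTop
          (nhds (((R : ℝ) - 1) ^ k * Real.exp (-((R : ℝ) - 1)) / (Nat.factorial k : ℝ))) :=
  ⟨BoundedDegree.tendsto_proportion_of_not (BoundedDegree.tendsto_proportion_not_noDegreeLT R),
    fun _ hε => BoundedDegree.tendsto_proportion_numDegree_sub_one hR hε,
    fun k => BoundedDegree.tendsto_proportion_numDegree_eq hR k⟩
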